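/- Let $K$ be a field, let $S=K[x_1,\dots,x_n,y_1,\dots,y_n]$ with the $\mathbb Z^n$-grading $\deg x_i=\deg y_i=e_i$, and fix a term order on $S$ with $x_i>y_i$ for all $i$. Let $G$ be a simple graph on the vertex set $[n]=\{1,\dots,n\}$, and let $J_G=(x_iy_j-x_jy_i : \{i,j\}\text{ is an edge of }G)\subseteq S$ be its binomial edge ideal. Let $\operatorname{gin}(J_G)\subseteq S$ denote its $\mathbb Z^n$-graded generic initial ideal, i.e. the ideal $J$ such that $\operatorname{in}(g\,J_G)=J$ for all $g=(g_1,\dots,g_n)$ in some nonempty Zariski open subset (defined over $K$) of the group $\mathrm{GL}_2^n$, where $g_i$ acts by linear substitutions of $x_i,y_i$, and where points $g$ over arbitrary extension fields $L\supseteq K$ are allowed, the equality then being read in $L\otimes_K S$. For $T\subseteq[n]$ let $G_T$ be the restriction (induced subgraph) of $G$ to $T$, and let $c(G_T)$ be its number of connected components. For a set $E\subseteq T$ that contains exactly one vertex of each connected component of $G_T$, put $$U_{T,E}=(x_i : i\in T\setminus E)+\sum_{i\in[n]\setminus T}(x_i,y_i).$$ Then $\operatorname{gin}(J_G)$ exists,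 and its minimal primes are exactly the ideals $U_{T,E}$, where $T$ ranges over the subsets of $[n]$ such that $c(G_{T\cup\{i\}})<c(G_T)$ for every $i\in[n]\setminus T$, and $E$ ranges over the subsets of $T$ that contain exactly one vertex of each connected component of $G_T$. -/

import Mathlib

namespace BinomialEdge

universe u

/-- The initial ideal of `I` with respect to the term order `m`: the ideal generated by the
leading terms of all elements of `I`. -/
noncomputable def initialIdeal {σ : Type*} {L : Type*} [Field L] (m : MonomialOrder σ)
    (I : Ideal (MvPolynomial σ L)) : Ideal (MvPolynomial σ L) :=
  Ideal.span (m.leadingTerm '' (I : Set (MvPolynomial σ L)))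

/-- A multigraded linear change of coordinates on `L[z_{ik} : i ∈ ι, k ∈ κ]`, where `z_{ik}` has
degree `e_i`: the `L`-algebra endomorphism sending `z_{ik}` to `∑ l, (g i)_{kl} z_{il}`.
For `g i` invertible these are exactly the automorphisms given by the group `∏ i, GL_κ(L)`. -/
noncomputable def coordChange {ι κ : Type*} [Fintype κ] {L : Type*} [Field L]
    (g : ι → Matrix κ κ L) : MvPolynomial (ι × κ) L →ₐ[L] MvPolynomial (ι × κ) L :=
  MvPolynomial.aeval fun p => ∑ l, MvPolynomial.C (g p.1 p.2 l) * MvPolynomial.X (p.1, l)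

/-- `IsMultigradedGin m I J`: the ideal `J` is the multigraded generic initial ideal of `I` with
respect to the term order `m`, i.e. `in(g I) = J` for all `g` in a nonempty Zariski open subset
`{D ≠ 0}` of the algebraic group `∏ i, GL_κ` over `K`.
The open subset is tested on points with values in all extension fields `L` of `K`. For `L = K`
this is the usual condition when `K` is infinite; the extensions make the notion meaningful when
`K` is finite as well (a nonempty open subset may then have no `K`-rational point). -/
def IsMultigradedGin {ι κ : Type*} [Fintype κ] [DecidableEq κ] {K : Type u} [Field K]
    (m : MonomialOrder (ι × κ)) (I J : Ideal (MvPolynomial (ι × κ) K)) : Prop :=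
  ∃ D : MvPolynomial (ι × κ × κ) K, D ≠ 0 ∧
    ∀ (L : Type u) [Field L] [Algebra K L] (g : ι → GL κ L),
      MvPolynomial.aeval (fun e : ι × κ × κ => (g e.1 : Matrix κ κ L) e.2.1 e.2.2) D ≠ 0 →
      initialIdeal m ((I.map (MvPolynomial.map (algebraMap K L))).map
          (coordChange fun i => (g i : Matrix κ κ L)))
        = J.map (MvPolynomial.map (algebraMap K L))

/-- The variable `x_i` of `S = K[x_1, …, x_n, y_1, …, y_n]`. -/
noncomputable def x (K : Type*) [Field K] {n : ℕ} (i : Fin n) : MvPolynomial (Fin n × Fin 2) K :=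
  MvPolynomial.X (i, 0)

/-- The variable `y_i` of `S = K[x_1, …, x_n, y_1, …, y_n]`. -/
noncomputable def y (K : Type*) [Field K] {n : ℕ} (i : Fin n) : MvPolynomial (Fin n × Fin 2) K :=
  MvPolynomial.X (i, 1)

/-- The binomial edge ideal `J_G`, generated by the minors `x_i y_j - x_j y_i` for the edges
`{i, j}` of `G`. -/
noncomputable def edgeIdeal (K : Type*) [Field K] {n : ℕ} (G : SimpleGraph (Fin n)) :
    Ideal (MvPolynomial (Fin n × Fin 2) K) :=
  Ideal.span {f | ∃ i j, G.Adj i j ∧ f = x K i * y K j - x K j * y K i}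

/-- The number `c(G_T)` of connected components of the restriction of `G` to `T`. -/
noncomputable def numComponents {n : ℕ} (G : SimpleGraph (Fin n)) (T : Set (Fin n)) : ℕ :=
  Nat.card (G.induce T).ConnectedComponent

/-- `E` is a subset of `T` containing exactly one vertex of each connected component of `G_T`. -/
def IsTransversal {n : ℕ} (G : SimpleGraph (Fin n)) (T E : Set (Fin n)) : Prop :=
  E ⊆ T ∧ ∀ C : (G.induce T).ConnectedComponent,
    ∃! v : T, (v : Fin n) ∈ E ∧ (G.induce T).connectedComponentMk v = C

/-- The ideal `U_{T,E} = (x_i : i ∈ T \ E) + ∑_{i ∉ T} (x_i, y_i)`. -/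
noncomputable def U (K : Type*) [Field K] {n : ℕ} (T E : Set (Fin n)) :
    Ideal (MvPolynomial (Fin n × Fin 2) K) :=
  Ideal.span (x K '' (T \ E)) ⊔ ⨆ i ∈ Tᶜ, Ideal.span {x K i, y K i}

end BinomialEdge

/-! The generic initial ideal is computed outright: it is the intersection `ginIdeal` of all `U K T
E` with `E` a transversal of the components of `G_T`. A monomial with vertex support `T` lies in it
exactly when `x_i x_j` divides it for two distinct vertices `i`, `j` of one component of `G_T`. Such
a monomial is a leading monomial: Plücker relations along a path from `i` to `j` put the transformed
minor of `i`, `j`, times one variable per inner vertex, into the ideal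
(`prod_X_mul_coordMinor_mem`), and generically the minor has leading monomial `x_i x_j`. Conversely,
if a leading monomial avoided some `U L T E`, evaluation at a family of points where the transformed
vectors are parallel on each component of `G_T` would kill the polynomial but not its leading
coefficient (`exists_mem_variableSet_of_mem_coordIdeal`). Minimal primes then correspond to
inclusion-maximal pairs `(T, E)`, identified in `isTransversal_maximal_iff`. Uniqueness, proved at
the generic point, carries the result to every gin. -/

namespace BinomialEdge

open MvPolynomial

/-! ### Transversals of the components of induced subgraphs. -/

section Transversal

variable {n : ℕ} {G : SimpleGraph (Fin n)} {T T' E B : Set (Fin n)} {u v w i : Fin n}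

/-- `u` and `v` lie in the same connected component of the restriction of `G` to `T`. -/
def Linked (G : SimpleGraph (Fin n)) (T : Set (Fin n)) (u v : Fin n) : Prop :=
  ∃ (hu : u ∈ T) (hv : v ∈ T), (G.induce T).Reachable ⟨u, hu⟩ ⟨v, hv⟩

theorem Linked.refl (hu : u ∈ T) : Linked G T u u := ⟨hu, hu, .refl _⟩

theorem Linked.symm (h : Linked G T u v) : Linked G T v u :=
  let ⟨hu, hv, h⟩ := h; ⟨hv, hu, h.symm⟩

theorem Linked.trans (h : Linked G T u v) (h' : Linked G T v w) : Linked G T u w :=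
  let ⟨hu, _, h⟩ := h; let ⟨_, hw, h'⟩ := h'; ⟨hu, hw, h.trans h'⟩

theorem Linked.of_adj (hu : u ∈ T) (hv : v ∈ T) (h : G.Adj u v) : Linked G T u v :=
  ⟨hu, hv, SimpleGraph.Adj.reachable (by simpa using h)⟩

theorem Linked.mono (hT : T ⊆ T') (h : Linked G T u v) : Linked G T' u v :=
  let ⟨hu, hv, h⟩ := h
  ⟨hT hu, hT hv, h.map (SimpleGraph.induceHomOfLE G hT).toHom⟩

theorem isTransversal_iff : IsTransversal G T E ↔
    E ⊆ T ∧ (∀ v ∈ T, ∃ e ∈ E, Linked G T v e) ∧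
      ∀ e ∈ E, ∀ e' ∈ E, Linked G T e e' → e = e' := by
  refine and_congr_right fun hE => ⟨fun h => ⟨fun v hv => ?_, ?_⟩, fun h C => ?_⟩
  · obtain ⟨e, ⟨he, hC⟩, -⟩ := h ((G.induce T).connectedComponentMk ⟨v, hv⟩)
    exact ⟨e, he, Linked.symm ⟨e.2, hv, SimpleGraph.ConnectedComponent.exact hC⟩⟩
  · rintro e he e' he' ⟨h1, h2, hr⟩
    have := (h ((G.induce T).connectedComponentMk ⟨e', h2⟩)).unique
      (y₁ := ⟨e, h1⟩) (y₂ := ⟨e', h2⟩) ⟨he, SimpleGraph.ConnectedComponent.sound hr⟩ ⟨he', rfl⟩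
    exact congrArg Subtype.val this
  · induction C using SimpleGraph.ConnectedComponent.ind with
    | h v =>
    obtain ⟨e, he, hv, heT, hr⟩ := h.1 v v.2
    refine ⟨⟨e, heT⟩, ⟨he, SimpleGraph.ConnectedComponent.sound hr.symm⟩, ?_⟩
    rintro ⟨e', h'⟩ ⟨he', hC⟩
    exact Subtype.ext (h.2 e' he' e he
      ⟨h', heT, (SimpleGraph.ConnectedComponent.exact hC).trans hr⟩)

/-- A set meeting every component of `G_T` in at most one vertex extends to a transversal. -/
theorem exists_isTransversal (hB : B ⊆ T)
    (h : ∀ b ∈ B, ∀ b' ∈ B, Linked G T b b' → b = b') :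
    ∃ E, B ⊆ E ∧ IsTransversal G T E := by
  classical
  -- Each component gets a representative, taken from `B` whenever the component meets `B`.
  have key : ∀ v : T, ∃ w, Linked G T v w ∧ ((∃ b ∈ B, Linked G T v b) → w ∈ B) := fun v => by
    by_cases hv : ∃ b ∈ B, Linked G T v b
    · obtain ⟨b, hb, hvb⟩ := hv
      exact ⟨b, hvb, fun _ => hb⟩
    · exact ⟨v, Linked.refl v.2, fun h => (hv h).elim⟩
  choose r hr hrB using key
  let ρ : (G.induce T).ConnectedComponent → Fin n := fun C => r C.out
  have hρ : ∀ v (hv : v ∈ T), Linked G T v (ρ ((G.induce T).connectedComponentMk ⟨v, hv⟩)) := by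
    intro v hv
    refine Linked.trans ?_ (hr _)
    exact ⟨hv, Subtype.property _, (SimpleGraph.ConnectedComponent.exact (Quot.out_eq _)).symm⟩
  have hlink : ∀ C C', Linked G T (ρ C) (ρ C') → C = C' := by
    intro C C' hC
    obtain ⟨_, _, hh⟩ := ((hr C.out).trans hC).trans (hr C'.out).symm
    have := SimpleGraph.ConnectedComponent.sound hh
    rw [← Quot.out_eq C, ← Quot.out_eq C']
    exact this
  refine ⟨Set.range ρ, fun b hb => ?_, isTransversal_iff.2 ⟨?_, fun v hv => ⟨_, ⟨_, rfl⟩, hρ v hv⟩, ?_⟩⟩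
  · refine ⟨(G.induce T).connectedComponentMk ⟨b, hB hb⟩, ?_⟩
    have h1 := hρ b (hB hb)
    exact (h b hb _ (hrB _ ⟨b, hb, (hr _).trans h1.symm⟩) h1).symm
  · rintro _ ⟨C, rfl⟩
    exact (hr C.out).2.1
  · rintro _ ⟨C, rfl⟩ _ ⟨C', rfl⟩ hC
    rw [hlink C C' hC]

/-- A walk either stays in `T` or passes through `i`, and then its initial part joins `u` to `i`. -/
theorem Linked.of_insert (h : Linked G (insert i T) u v) (hu : u ∈ T) :
    Linked G T u v ∨ Linked G (insert i T) u i := by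
  obtain ⟨hu', hv', ⟨p⟩⟩ := h
  suffices H : ∀ (a b : (insert i T : Set (Fin n))) (_ : (G.induce (insert i T)).Walk a b),
      (a : Fin n) ∈ T → Linked G T a b ∨ Linked G (insert i T) a i from H _ _ p hu
  intro a b p
  induction p with
  | nil => exact fun ha => .inl (.refl ha)
  | @cons a c b hac _ ih =>
    intro ha
    have hac' : G.Adj a c := by simpa using hac
    rcases c.2 with hc | hc
    · right
      rw [hc] at hac'
      exact .of_adj a.2 (Set.mem_insert i T) hac'
    · refine (ih hc).imp (fun h => (Linked.of_adj ha hc hac').trans h)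
        fun h => (Linked.of_adj a.2 c.2 hac').trans h

/-- The map on connected components induced by an inclusion of vertex sets. -/
def componentMap (G : SimpleGraph (Fin n)) (hT : T ⊆ T') :
    (G.induce T).ConnectedComponent → (G.induce T').ConnectedComponent :=
  SimpleGraph.ConnectedComponent.map (SimpleGraph.induceHomOfLE G hT).toHom

theorem componentMap_injective_iff (hT : T ⊆ T') : Function.Injective (componentMap G hT) ↔
    ∀ u ∈ T, ∀ v ∈ T, Linked G T' u v → Linked G T u v := by
  constructor
  · rintro h u hu v hv ⟨hu', hv', hr⟩
    refine ⟨hu, hv, SimpleGraph.ConnectedComponent.exact (h ?_)⟩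
    exact SimpleGraph.ConnectedComponent.sound hr
  · intro h C C' hC
    induction C using SimpleGraph.ConnectedComponent.ind with
    | h v =>
    induction C' using SimpleGraph.ConnectedComponent.ind with
    | h v' =>
    obtain ⟨_, _, hr⟩ := h v v.2 v' v'.2
      ⟨hT v.2, hT v'.2, SimpleGraph.ConnectedComponent.exact hC⟩
    exact SimpleGraph.ConnectedComponent.sound hr

/-- The count drops exactly when `componentMap` fails to be injective. When it fails, `i` is linked
to a vertex of `T`, so the map is also surjective. -/
theorem numComponents_insert_lt_iff : numComponents G (insert i T) < numComponents G T ↔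
    ∃ u ∈ T, ∃ v ∈ T, Linked G (insert i T) u v ∧ ¬ Linked G T u v := by
  have hT := Set.subset_insert i T
  have hinj := componentMap_injective_iff (G := G) hT
  constructor
  · intro h
    by_contra! hc
    exact absurd (Nat.card_le_card_of_injective _ (hinj.2 hc)) (not_le.2 h)
  · rintro ⟨u, hu, v, hv, hl, hn⟩
    have hui := (hl.of_insert hu).resolve_left hn
    have hsurj : Function.Surjective (componentMap G hT) := by
      intro C
      induction C using SimpleGraph.ConnectedComponent.ind with
      | h w =>
      obtain ⟨w, hw⟩ := w
      rcases hw with rfl | hw'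
      · obtain ⟨_, _, hr⟩ := hui
        exact ⟨(G.induce T).connectedComponentMk ⟨u, hu⟩, SimpleGraph.ConnectedComponent.sound hr⟩
      · exact ⟨(G.induce T).connectedComponentMk ⟨w, hw'⟩, rfl⟩
    refine lt_of_le_of_ne (Nat.card_le_card_of_surjective _ hsurj) fun heq => ?_
    have hbij := (Nat.bijective_iff_surjective_and_card _).2 ⟨hsurj, heq.symm⟩
    exact hn (hinj.1 hbij.1 u hu v hv hl)

/-- The transversals `(T, E)` that are maximal with respect to inclusion are those for which
adding any vertex to `T` joins components. -/
theorem isTransversal_maximal_iff (hE : IsTransversal G T E) :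
    (∀ i, i ∉ T → numComponents G (insert i T) < numComponents G T) ↔
      ∀ T' E', IsTransversal G T' E' → T ⊆ T' → E ⊆ E' → T' = T ∧ E' = E := by
  obtain ⟨hET, hex, huniq⟩ := isTransversal_iff.1 hE
  constructor
  · intro h T' E' hE' hTT hEE
    obtain ⟨hET', -, huniq'⟩ := isTransversal_iff.1 hE'
    have hT : T' = T := by
      by_contra hne
      obtain ⟨i, hi, hiT⟩ := Set.exists_of_ssubset (hTT.ssubset_of_ne (Ne.symm hne))
      -- Two components of `G_T` merge; their points of `E` both lie in `E'`, which has only one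
      -- point in the merged component.
      obtain ⟨u, hu, v, hv, hl, hn⟩ := numComponents_insert_lt_iff.1 (h i hiT)
      obtain ⟨e, he, hue⟩ := hex u hu
      obtain ⟨f, hf, hvf⟩ := hex v hv
      have : e = f := huniq' e (hEE he) f (hEE hf)
        (((hue.mono hTT).symm.trans (hl.mono (Set.insert_subset hi hTT))).trans (hvf.mono hTT))
      subst this
      exact hn (hue.trans hvf.symm)
    subst hT
    refine ⟨rfl, (Set.Subset.antisymm hEE fun e' he' => ?_).symm⟩
    obtain ⟨e, he, hl⟩ := hex e' (hET' he')
    rwa [huniq' e' he' e (hEE he) hl]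
  · intro h i hi
    by_contra hlt
    rw [numComponents_insert_lt_iff] at hlt
    push Not at hlt
    -- Nothing merges, so `E` still meets each component at most once and extends to a larger pair.
    obtain ⟨E', hEE', hE'⟩ := exists_isTransversal (G := G) (hET.trans (Set.subset_insert i T))
      fun e he e' he' hl => huniq e he e' he' (hlt e (hET he) e' (hET he') hl)
    exact hi ((h _ _ hE' (Set.subset_insert i T) hEE').1 ▸ Set.mem_insert i T)

end Transversal

/-! ### Ideals generated by variables, and the minimal primes of `ginIdeal`. -/

section VariableIdeal

variable {σ : Type*} {K : Type*} [Field K]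

theorem isPrime_span_X (s : Set σ) : (Ideal.span (X '' s : Set (MvPolynomial σ K))).IsPrime := by
  classical
  let φ : MvPolynomial σ K →ₐ[K] MvPolynomial σ K := aeval fun p => if p ∈ s then 0 else X p
  suffices h : Ideal.span (X '' s) = RingHom.ker φ by
    rw [h]
    exact RingHom.ker_isPrime _
  -- Killing the variables in `s` is the identity modulo the ideal, so the kernel of `φ` is no
  -- larger than the ideal.
  have hsub : ∀ f, f - φ f ∈ Ideal.span (X '' s : Set (MvPolynomial σ K)) := by
    intro f
    have : (Ideal.Quotient.mkₐ K (Ideal.span (X '' s : Set (MvPolynomial σ K)))).comp φ =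
        Ideal.Quotient.mkₐ K _ := by
      ext p
      by_cases hp : p ∈ s
      · have : X p ∈ Ideal.span (X '' s : Set (MvPolynomial σ K)) :=
          Ideal.subset_span ⟨p, hp, rfl⟩
        simp [φ, hp, Ideal.Quotient.eq_zero_iff_mem.2 this]
      · simp [φ, hp]
    exact Ideal.Quotient.eq.1 (DFunLike.congr_fun this f).symm
  refine le_antisymm (Ideal.span_le.2 ?_) fun f hf => ?_
  · rintro _ ⟨p, hp, rfl⟩
    simp [φ, hp]
  · simpa [RingHom.mem_ker.1 hf] using hsub f

/-- A set of variables generating `U K T E`. -/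
def variableSet {n : ℕ} (T E : Set (Fin n)) : Set (Fin n × Fin 2) :=
  {p | p.1 ∉ T ∨ (p.1 ∉ E ∧ p.2 = 0)}

theorem U_eq_span {n : ℕ} (T E : Set (Fin n)) :
    U K T E = Ideal.span (X '' variableSet T E) := by
  apply le_antisymm
  · refine sup_le (Ideal.span_mono ?_) (iSup₂_le fun i hi => Ideal.span_mono ?_)
    · rintro _ ⟨i, hi, rfl⟩
      exact ⟨(i, 0), .inr ⟨hi.2, rfl⟩, rfl⟩
    · rintro _ (rfl | rfl)
      exacts [⟨(i, 0), .inl hi, rfl⟩, ⟨(i, 1), .inl hi, rfl⟩]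
  · rw [Ideal.span_le]
    rintro _ ⟨⟨i, k⟩, h, rfl⟩
    by_cases hi : i ∈ T
    · obtain ⟨hE, rfl⟩ := h.resolve_left (not_not.2 hi)
      exact Ideal.mem_sup_left (Ideal.subset_span ⟨i, ⟨hi, hE⟩, rfl⟩)
    · refine Ideal.mem_sup_right (Ideal.mem_iSup_of_mem i (Ideal.mem_iSup_of_mem hi
        (Ideal.subset_span ?_)))
      fin_cases k
      exacts [.inl rfl, .inr rfl]

theorem mem_U_iff {n : ℕ} {T E : Set (Fin n)} {f : MvPolynomial (Fin n × Fin 2) K} :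
    f ∈ U K T E ↔ ∀ d ∈ f.support, ∃ p ∈ variableSet T E, d p ≠ 0 := by
  rw [U_eq_span, mem_ideal_span_X_image]

theorem monomial_mem_U_iff {n : ℕ} {T E : Set (Fin n)} {d : Fin n × Fin 2 →₀ ℕ} :
    monomial d (1 : K) ∈ U K T E ↔ ∃ p ∈ variableSet T E, d p ≠ 0 := by
  classical
  simp [mem_U_iff, support_monomial]

theorem isPrime_U {n : ℕ} (T E : Set (Fin n)) : (U K T E).IsPrime :=
  U_eq_span (K := K) T E ▸ isPrime_span_X _

/-- The variables `y_i` in the ideal detect `T`, and the variables `x_i` detect `E`. The order is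
reversed, so minimal primes come from maximal pairs. -/
theorem U_le_U_iff {n : ℕ} {T E T' E' : Set (Fin n)} (hE : E ⊆ T) :
    U K T' E' ≤ U K T E ↔ T ⊆ T' ∧ E ⊆ E' := by
  have hX : ∀ p, X p ∈ U K T E ↔ p ∈ variableSet T E := by
    intro p
    rw [X, monomial_mem_U_iff]
    exact ⟨fun ⟨q, hq, h⟩ => by
      classical
      rw [Finsupp.single_apply] at h
      simp only [ne_eq, ite_eq_right_iff, one_ne_zero, imp_false, not_not] at h
      rwa [h], fun h => ⟨p, h, by simp⟩⟩
  rw [U_eq_span T' E', Ideal.span_le, Set.image_subset_iff]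
  constructor
  · intro h
    refine ⟨fun i hi => ?_, fun i hi => ?_⟩
    · by_contra hc
      rcases (hX _).1 (h (a := (i, 1)) (.inl hc)) with h | h
      · exact h hi
      · exact absurd h.2 one_ne_zero
    · by_contra hc
      rcases (hX _).1 (h (a := (i, 0)) (.inr ⟨hc, rfl⟩)) with h | h
      · exact h (hE hi)
      · exact h.1 hi
  · rintro ⟨hT, hEE⟩ p hp
    refine (hX p).2 ?_
    rcases hp with hp | ⟨hp, hp'⟩
    · exact .inl fun h => hp (hT h)
    · exact .inr ⟨fun h => hp (hEE h), hp'⟩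

/-- The intersection of the ideals `U K T E` over all sets of vertices `T` and all transversals. -/
noncomputable def ginIdeal (K : Type*) [Field K] {n : ℕ} (G : SimpleGraph (Fin n)) :
    Ideal (MvPolynomial (Fin n × Fin 2) K) :=
  ⨅ (T : Set (Fin n)) (E : Set (Fin n)) (_ : IsTransversal G T E), U K T E

theorem mem_ginIdeal_iff {n : ℕ} {G : SimpleGraph (Fin n)}
    {f : MvPolynomial (Fin n × Fin 2) K} :
    f ∈ ginIdeal K G ↔ ∀ T E, IsTransversal G T E → f ∈ U K T E := by
  simp [ginIdeal]

theorem ginIdeal_le_isPrime {n : ℕ} {G : SimpleGraph (Fin n)}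
    {P : Ideal (MvPolynomial (Fin n × Fin 2) K)} (hP : P.IsPrime) (h : ginIdeal K G ≤ P) :
    ∃ T E, IsTransversal G T E ∧ U K T E ≤ P := by
  classical
  let s : Finset (Set (Fin n) × Set (Fin n)) := Finset.univ.filter fun q => IsTransversal G q.1 q.2
  have hs : s.inf (fun q => U K q.1 q.2) ≤ P := by
    refine le_trans (fun f hf => mem_ginIdeal_iff.2 fun T E hE => ?_) h
    exact (Finset.inf_le (f := fun q : Set (Fin n) × Set (Fin n) => U K q.1 q.2)
      (show (T, E) ∈ s by simpa [s] using hE)) hf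
  obtain ⟨q, hq, hle⟩ := hP.inf_le'.1 hs
  exact ⟨q.1, q.2, by simpa [s] using hq, hle⟩

theorem minimalPrimes_ginIdeal {n : ℕ} (G : SimpleGraph (Fin n)) :
    (ginIdeal K G).minimalPrimes =
      {P | ∃ T E : Set (Fin n),
        (∀ i, i ∉ T → numComponents G (insert i T) < numComponents G T) ∧
        IsTransversal G T E ∧ P = U K T E} := by
  have hle : ∀ {T E}, IsTransversal G T E → ginIdeal K G ≤ U K T E :=
    fun hE f hf => mem_ginIdeal_iff.1 hf _ _ hE
  ext P
  constructor
  · rintro ⟨⟨hP, hP'⟩, hmin⟩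
    obtain ⟨T, E, hE, hUP⟩ := ginIdeal_le_isPrime hP hP'
    have hPU := le_antisymm (hmin ⟨isPrime_U T E, hle hE⟩ hUP) hUP
    refine ⟨T, E, (isTransversal_maximal_iff hE).2 fun T' E' hE' hT hEE => ?_, hE, hPU⟩
    have h1 := (U_le_U_iff (K := K) hE.1).2 ⟨hT, hEE⟩
    have h2 := (hmin ⟨isPrime_U T' E', hle hE'⟩ (h1.trans hUP))
    have h3 := (U_le_U_iff (K := K) hE'.1).1 (hUP.trans h2)
    exact ⟨h3.1.antisymm hT, h3.2.antisymm hEE⟩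
  · rintro ⟨T, E, hT, hE, rfl⟩
    refine ⟨⟨isPrime_U T E, hle hE⟩, ?_⟩
    rintro Q ⟨hQ, hQ'⟩ hQU
    obtain ⟨T', E', hE', hUQ⟩ := ginIdeal_le_isPrime hQ hQ'
    obtain ⟨h1, h2⟩ := (U_le_U_iff hE.1).1 (hUQ.trans hQU)
    obtain ⟨rfl, rfl⟩ := (isTransversal_maximal_iff hE).1 hT _ _ hE' h1 h2
    exact hUQ

end VariableIdeal

/-! ### Every leading monomial lies in every `U L T E`. -/

section GenericCoordinates

variable {n : ℕ} {L : Type*} [Field L] {G : SimpleGraph (Fin n)}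

/-- The image of the variable `z_{ik}` under the coordinate change given by `g`. -/
noncomputable def coordVec (g : Fin n → Matrix (Fin 2) (Fin 2) L) (i : Fin n) (k : Fin 2) :
    MvPolynomial (Fin n × Fin 2) L :=
  ∑ l, C (g i k l) * X (i, l)

/-- The image of the binomial `x_i y_j - x_j y_i` under the coordinate change given by `g`. -/
noncomputable def coordMinor (g : Fin n → Matrix (Fin 2) (Fin 2) L) (i j : Fin n) :
    MvPolynomial (Fin n × Fin 2) L :=
  coordVec g i 0 * coordVec g j 1 - coordVec g j 0 * coordVec g i 1

/-- The image of the binomial edge ideal under the coordinate change given by `g`. -/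
noncomputable def coordIdeal (G : SimpleGraph (Fin n)) (g : Fin n → Matrix (Fin 2) (Fin 2) L) :
    Ideal (MvPolynomial (Fin n × Fin 2) L) :=
  Ideal.span {f | ∃ i j, G.Adj i j ∧ f = coordMinor g i j}

theorem map_edgeIdeal {K : Type*} [Field K] [Algebra K L]
    (g : Fin n → Matrix (Fin 2) (Fin 2) L) :
    ((edgeIdeal K G).map (MvPolynomial.map (algebraMap K L))).map (coordChange g) =
      coordIdeal G g := by
  have key : ∀ i j, coordChange g (MvPolynomial.map (algebraMap K L)
      (x K i * y K j - x K j * y K i)) = coordMinor g i j := by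
    intro i j
    simp [x, y, coordChange, coordMinor, coordVec]
  rw [edgeIdeal, Ideal.map_span, Ideal.map_span, coordIdeal]
  congr 1
  ext f
  constructor
  · rintro ⟨_, ⟨_, ⟨i, j, h, rfl⟩, rfl⟩, rfl⟩
    exact ⟨i, j, h, key i j⟩
  · rintro ⟨i, j, h, rfl⟩
    exact ⟨_, ⟨_, ⟨i, j, h, rfl⟩, rfl⟩, key i j⟩

/-- The genericity condition under which the initial ideal is computed. -/
def IsGeneric (g : Fin n → Matrix (Fin 2) (Fin 2) L) : Prop :=
  ∀ i j, i ≠ j → g i 0 0 * g j 1 0 - g j 0 0 * g i 1 0 ≠ 0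

/-- The multidegree of a monomial, for the grading in which both `x_i` and `y_i` have degree
`e_i`. -/
noncomputable def multidegree (d : Fin n × Fin 2 →₀ ℕ) : Fin n →₀ ℕ :=
  Finsupp.equivFunOnFinite.symm fun i => d (i, 0) + d (i, 1)

/-- Within a fixed multidegree, `c` arises from `d` by replacing some `y_i` by `x_i`, and each
replacement raises the monomial. -/
theorem toSyn_le_of_multidegree_eq {m : MonomialOrder (Fin n × Fin 2)}
    (hm : ∀ i : Fin n, m.toSyn (Finsupp.single (i, 1) 1) < m.toSyn (Finsupp.single (i, 0) 1))
    {c d : Fin n × Fin 2 →₀ ℕ} (hcd : multidegree c = multidegree d)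
    (h : ∀ i, c (i, 1) ≤ d (i, 1)) : m.toSyn d ≤ m.toSyn c := by
  have hdeg : ∀ i, c (i, 0) + c (i, 1) = d (i, 0) + d (i, 1) := fun i => DFunLike.congr_fun hcd i
  choose k hk using fun i => Nat.exists_eq_add_of_le (h i)
  have hsum : ∀ a i b, (∑ j, k j • Finsupp.single (j, a) 1 : Fin n × Fin 2 →₀ ℕ) (i, b) =
      if a = b then k i else 0 := by
    intro a i b
    rw [Finsupp.finsetSum_apply, Finset.sum_eq_single i]
    · simp [Finsupp.single_apply]
    · intro j _ hj
      simp [hj]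
    · simp
  let r : Fin n × Fin 2 →₀ ℕ := c ⊓ d
  have hd : d = r + ∑ i, k i • Finsupp.single (i, 1) 1 := by
    ext ⟨i, l⟩
    have := hk i
    have := hdeg i
    rw [Finsupp.add_apply, hsum, Finsupp.inf_apply]
    fin_cases l <;> simp <;> omega
  have hc : c = r + ∑ i, k i • Finsupp.single (i, 0) 1 := by
    ext ⟨i, l⟩
    have := hk i
    have := hdeg i
    rw [Finsupp.add_apply, hsum, Finsupp.inf_apply]
    fin_cases l <;> simp <;> omega
  calc m.toSyn d = m.toSyn r + ∑ i, k i • m.toSyn (Finsupp.single (i, 1) 1) := by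
        conv_lhs => rw [hd]
        simp only [map_add, map_sum, map_nsmul]
    _ ≤ m.toSyn r + ∑ i, k i • m.toSyn (Finsupp.single (i, 0) 1) := by
        gcongr with i
        exact (hm i).le
    _ = m.toSyn c := by
        conv_rhs => rw [hc]
        simp only [map_add, map_sum, map_nsmul]

theorem le_of_X_pow_dvd {σ : Type*} {p : MvPolynomial σ L} {i : σ} {k : ℕ} {d : σ →₀ ℕ}
    (h : X i ^ k ∣ p) (hd : coeff d p ≠ 0) : k ≤ d i := by
  classical
  obtain ⟨q, rfl⟩ := h
  rw [X_pow_eq_monomial, coeff_monomial_mul'] at hd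
  by_contra hc
  exact hd (if_neg fun hle => hc (by simpa using hle i))

/-- The evaluation sending `z_{ik}` to `t_i w_{ik}`. -/
noncomputable def scaledEval (w : Fin n × Fin 2 → MvPolynomial (Fin n) L) :
    MvPolynomial (Fin n × Fin 2) L →ₐ[L] MvPolynomial (Fin n) (MvPolynomial (Fin n) L) :=
  aeval fun p => X p.1 * C (w p)

theorem scaledEval_monomial (w : Fin n × Fin 2 → MvPolynomial (Fin n) L)
    (d : Fin n × Fin 2 →₀ ℕ) (c : L) :
    scaledEval w (monomial d c) = monomial (multidegree d) (C c * ∏ p, w p ^ d p) := by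
  rw [scaledEval, aeval_monomial, Finsupp.prod_fintype _ _ (fun _ => pow_zero _)]
  simp only [mul_pow, Finset.prod_mul_distrib]
  rw [monomial_eq, Finsupp.prod_fintype _ _ (fun _ => pow_zero _)]
  have : ∏ p : Fin n × Fin 2, (X p.1 : MvPolynomial (Fin n) (MvPolynomial (Fin n) L)) ^ d p =
      ∏ i, X i ^ multidegree d i := by
    rw [Fintype.prod_prod_type]
    simp [multidegree, pow_add]
  rw [this]
  simp only [map_mul, map_prod, map_pow, IsScalarTower.algebraMap_apply L (MvPolynomial (Fin n) L),
    MvPolynomial.algebraMap_eq]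
  ring

/-- The outer variables `t_i` record the multidegree, so an outer coefficient sees only one
multihomogeneous component of `f`. -/
theorem coeff_coeff_scaledEval (w : Fin n × Fin 2 → MvPolynomial (Fin n) L)
    (f : MvPolynomial (Fin n × Fin 2) L) (a b : Fin n →₀ ℕ) :
    coeff b (coeff a (scaledEval w f)) =
      ∑ d ∈ f.support,
        if multidegree d = a then coeff d f * coeff b (∏ p, w p ^ d p) else 0 := by
  classical
  conv_lhs => rw [f.as_sum]
  simp only [map_sum, scaledEval_monomial, coeff_sum, coeff_monomial]
  refine Finset.sum_congr rfl fun d _ => ?_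
  split_ifs <;> simp

/-- The leading monomial of an element of the transformed binomial edge ideal lies in all the
ideals `U L T E`. -/
theorem exists_mem_variableSet_of_mem_coordIdeal {m : MonomialOrder (Fin n × Fin 2)}
    (hm : ∀ i : Fin n, m.toSyn (Finsupp.single (i, 1) 1) < m.toSyn (Finsupp.single (i, 0) 1))
    {g : Fin n → GL (Fin 2) L} (hg : IsGeneric fun i => (g i : Matrix (Fin 2) (Fin 2) L))
    {T E : Set (Fin n)} (hE : IsTransversal G T E) {f : MvPolynomial (Fin n × Fin 2) L}
    (hf : f ∈ coordIdeal G fun i => (g i : Matrix (Fin 2) (Fin 2) L)) (hf0 : f ≠ 0) :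
    ∃ p ∈ variableSet T E, m.degree f p ≠ 0 := by
  classical
  obtain ⟨hET, hex, huniq⟩ := isTransversal_iff.1 hE
  by_contra! hcon
  have hd0 : ∀ i, i ∉ E → m.degree f (i, 0) = 0 := fun i hi => hcon _ (.inr ⟨hi, rfl⟩)
  have hdT : ∀ i, i ∉ T → ∀ k, m.degree f (i, k) = 0 := fun i hi k => hcon _ (.inl hi)
  have hrep : ∀ i, ∃ e, i ∈ T → e ∈ E ∧ Linked G T i e := fun i => by
    by_cases hi : i ∈ T
    · obtain ⟨e, he⟩ := hex i hi
      exact ⟨e, fun _ => he⟩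
    · exact ⟨i, fun h => (hi h).elim⟩
  choose r hr using hrep
  have hrE : ∀ i ∈ E, r i = i := fun i hi =>
    (huniq i hi _ (hr i (hET hi)).1 (hr i (hET hi)).2).symm
  -- For `i ∈ T` the point is `w_i = h_i (1, s_{r i})`, so `g_i w_i = g_{r i} (1, s_{r i})` depends
  -- only on the component of `i`, and the minors of edges vanish. At `i ∈ E` it is simply `(1,
  -- s_i)`.
  let h : Fin n → Matrix (Fin 2) (Fin 2) L := fun i => ((g i)⁻¹ * g (r i) : GL (Fin 2) L)
  have hgh : ∀ i, (g i : Matrix (Fin 2) (Fin 2) L) * h i = g (r i) := fun i => by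
    simp only [h, ← Units.val_mul, mul_inv_cancel_left]
  have hentry : ∀ i k l, (g i : Matrix (Fin 2) (Fin 2) L) k 0 * h i 0 l +
      (g i : Matrix (Fin 2) (Fin 2) L) k 1 * h i 1 l = (g (r i) : Matrix (Fin 2) (Fin 2) L) k l :=
    fun i k l => by rw [← hgh i, Matrix.mul_apply, Fin.sum_univ_two]
  let w : Fin n × Fin 2 → MvPolynomial (Fin n) L := fun p =>
    if p.1 ∈ T then C (h p.1 p.2 0) + C (h p.1 p.2 1) * X (r p.1) else 0
  have hw0 : ∀ i ∈ E, w (i, 0) = 1 := fun i hi => by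
    have : h i = 1 := by simp [h, hrE i hi]
    simp [w, hET hi, this]
  have hw1 : ∀ i ∈ E, w (i, 1) = X i := fun i hi => by
    have : h i = 1 := by simp [h, hrE i hi]
    simp [w, hET hi, this, hrE i hi]
  have hwT : ∀ i, i ∉ T → ∀ k, w (i, k) = 0 := fun i hi k => by simp [w, hi]
  have hvec : ∀ i k, scaledEval w (coordVec (fun i => (g i : Matrix (Fin 2) (Fin 2) L)) i k) =
      if i ∈ T then X i * C (C ((g (r i) : Matrix (Fin 2) (Fin 2) L) k 0) +
        C ((g (r i) : Matrix (Fin 2) (Fin 2) L) k 1) * X (r i)) else 0 := by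
    intro i k
    by_cases hi : i ∈ T
    · rw [if_pos hi, ← hentry i k 0, ← hentry i k 1]
      simp only [coordVec, Fin.sum_univ_two, scaledEval, map_add, map_mul, aeval_X, w, hi, if_true,
        algHom_C, IsScalarTower.algebraMap_apply L (MvPolynomial (Fin n) L),
        MvPolynomial.algebraMap_eq]
      ring
    · simp [coordVec, scaledEval, w, hi]
  have hker : scaledEval w f = 0 := by
    have hle : coordIdeal G (fun i => (g i : Matrix (Fin 2) (Fin 2) L)) ≤
        RingHom.ker (scaledEval w) := by
      rw [coordIdeal, Ideal.span_le]
      rintro _ ⟨i, j, hij, rfl⟩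
      rw [SetLike.mem_coe, RingHom.mem_ker, coordMinor]
      simp only [map_sub, map_mul, hvec]
      by_cases hi : i ∈ T
      · by_cases hj : j ∈ T
        · have : r i = r j := huniq _ (hr i hi).1 _ (hr j hj).1
            (((hr i hi).2.symm.trans (.of_adj hi hj hij)).trans (hr j hj).2)
          simp only [hi, hj, if_true, this]
          ring
        · simp [hj]
      · simp [hi]
    exact hle hf
  -- The coefficient of this monomial, in the multidegree of the leading monomial, receives a
  -- contribution from the leading monomial alone.
  let b : Fin n →₀ ℕ :=
    Finsupp.equivFunOnFinite.symm fun i => if i ∈ E then m.degree f (i, 1) else 0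
  have hsum := coeff_coeff_scaledEval w f (multidegree (m.degree f)) b
  rw [hker, coeff_zero, coeff_zero, Finset.sum_eq_single (m.degree f)] at hsum
  · rw [if_pos rfl, eq_comm, mul_eq_zero, or_iff_right (m.coeff_degree_ne_zero_iff.2 hf0)] at hsum
    have hprod : ∏ p, w p ^ m.degree f p =
        monomial b 1 * ∏ i, if i ∈ E then 1 else w (i, 1) ^ m.degree f (i, 1) := by
      rw [monomial_eq, C_1, one_mul, Finsupp.prod_fintype _ _ (fun _ => pow_zero _),
        ← Finset.prod_mul_distrib, Fintype.prod_prod_type]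
      refine Finset.prod_congr rfl fun i _ => ?_
      rw [Fin.prod_univ_two]
      by_cases hi : i ∈ E
      · simp [hw0 i hi, hw1 i hi, b, hi]
      · simp [hd0 i hi, b, hi]
    rw [hprod, coeff_monomial_mul', if_pos le_rfl, one_mul, tsub_self, ← constantCoeff_eq,
      map_prod, Finset.prod_eq_zero_iff] at hsum
    obtain ⟨i, -, hi⟩ := hsum
    by_cases hiE : i ∈ E
    · simp [hiE] at hi
    rw [if_neg hiE, map_pow] at hi
    by_cases hiT : i ∈ T
    -- If this entry vanished, the first columns of `g i` and `g (r i)` would be proportional,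
    -- against genericity.
    · have hh : h i 1 0 = 0 := by simpa [w, hiT] using eq_zero_of_pow_eq_zero hi
      refine hg i (r i) (fun h => hiE (h ▸ (hr i hiT).1)) ?_
      simp only [← hentry, hh]
      ring
    · simp [hdT i hiT] at hi
  · intro d hd hne
    refine ite_eq_right_iff.2 fun hdeg => mul_eq_zero_of_right _ ?_
    by_contra hcoeff
    -- A contributing `d` has no more `y_i` than the leading monomial: for `i ∈ E` because `w (i, 1)
    -- = X i`, for `i ∉ E` because the leading monomial has no `x_i`. Hence `d` is at least as large
    -- as the leading monomial.
    refine hne (m.toSyn.injective (le_antisymm (m.le_degree hd)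
      (toSyn_le_of_multidegree_eq hm hdeg fun i => ?_)))
    have hdi : d (i, 0) + d (i, 1) = m.degree f (i, 0) + m.degree f (i, 1) :=
      DFunLike.congr_fun hdeg i
    by_cases hiE : i ∈ E
    · have hdvd : X i ^ d (i, 1) ∣ ∏ p, w p ^ d p := by
        rw [← hw1 i hiE]
        exact Finset.dvd_prod_of_mem (fun p => w p ^ d p) (Finset.mem_univ (i, 1))
      simpa [b, hiE] using le_of_X_pow_dvd hdvd hcoeff
    · have := hd0 i hiE
      omega
  · exact fun hn => (hn (m.degree_mem_support hf0)).elim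

end GenericCoordinates

/-! ### Every monomial of `ginIdeal` is a leading monomial up to a monomial factor. -/

section LeadingTerms

variable {n : ℕ} {L : Type*} [Field L] {G : SimpleGraph (Fin n)}

/-- Induction on the path: inverting `g k` writes either variable at `k` as a linear form in the
transformed pair at `k`, and a Plücker relation splits its product with the minor of `i`, `j` into
multiples of the minors of `i`, `k` and of `k`, `j`. -/
theorem prod_X_mul_coordMinor_mem (g : Fin n → GL (Fin 2) L) (κ : Fin n → Fin 2) {i j : Fin n}
    (p : G.Walk i j) (hp : p.IsPath) :
    (∏ a ∈ p.support.toFinset \ {i, j}, X (a, κ a)) *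
        coordMinor (fun i => (g i : Matrix (Fin 2) (Fin 2) L)) i j ∈
      coordIdeal G fun i => (g i : Matrix (Fin 2) (Fin 2) L) := by
  induction p with
  | nil => simp [coordMinor]
  | @cons i k j hik q ih =>
    rw [SimpleGraph.Walk.cons_isPath_iff] at hp
    have hmem : coordMinor (fun i => (g i : Matrix (Fin 2) (Fin 2) L)) i k ∈
        coordIdeal G fun i => (g i : Matrix (Fin 2) (Fin 2) L) :=
      Ideal.subset_span ⟨i, k, hik, rfl⟩
    by_cases hkj : k = j
    · subst hkj
      exact Ideal.mul_mem_left _ _ hmem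
    have hS : (SimpleGraph.Walk.cons hik q).support.toFinset \ {i, j} =
        insert k (q.support.toFinset \ {k, j}) := by
      ext a
      have hk : k ∈ q.support := q.start_mem_support
      have hi := hp.2
      simp only [SimpleGraph.Walk.support_cons, List.toFinset_cons, Finset.mem_sdiff,
        Finset.mem_insert, List.mem_toFinset, Finset.mem_singleton]
      grind
    rw [hS, Finset.prod_insert (by simp)]
    set P : Fin n → Fin 2 → MvPolynomial (Fin n × Fin 2) L :=
      coordVec fun i => (g i : Matrix (Fin 2) (Fin 2) L) with hP
    let ζ : (Fin 2 → MvPolynomial (Fin n × Fin 2) L) → MvPolynomial (Fin n × Fin 2) L := fun v =>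
      ∑ l, C (((g k)⁻¹ : GL (Fin 2) L) (κ k) l) * v l
    have hX : X (k, κ k) = ζ (P k) := by
      have hinv : ∀ l, ((g k)⁻¹ : GL (Fin 2) L) (κ k) 0 * (g k : Matrix (Fin 2) (Fin 2) L) 0 l +
          ((g k)⁻¹ : GL (Fin 2) L) (κ k) 1 * (g k : Matrix (Fin 2) (Fin 2) L) 1 l =
          (1 : Matrix (Fin 2) (Fin 2) L) (κ k) l := by
        intro l
        rw [← Fin.sum_univ_two
          (f := fun a => ((g k)⁻¹ : GL (Fin 2) L) (κ k) a * (g k : Matrix (Fin 2) (Fin 2) L) a l),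
          ← Matrix.mul_apply, ← Units.val_mul, inv_mul_cancel, Units.val_one]
      have h0 := congrArg (C (σ := Fin n × Fin 2)) (hinv 0)
      have h1 := congrArg (C (σ := Fin n × Fin 2)) (hinv 1)
      simp only [map_add, map_mul] at h0 h1
      have : ζ (P k) = C ((1 : Matrix (Fin 2) (Fin 2) L) (κ k) 0) * X (k, 0) +
          C ((1 : Matrix (Fin 2) (Fin 2) L) (κ k) 1) * X (k, 1) := by
        rw [← h0, ← h1]
        simp only [ζ, hP, coordVec, Fin.sum_univ_two]
        ring
      rw [this, Matrix.one_apply, Matrix.one_apply]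
      rcases Fin.exists_fin_two.1 ⟨κ k, rfl⟩ with hκ | hκ <;> simp [hκ]
    have hplucker : X (k, κ k) * coordMinor (fun i => (g i : Matrix (Fin 2) (Fin 2) L)) i j =
        ζ (P j) * coordMinor (fun i => (g i : Matrix (Fin 2) (Fin 2) L)) i k +
        ζ (P i) * coordMinor (fun i => (g i : Matrix (Fin 2) (Fin 2) L)) k j := by
      rw [hX]
      simp only [ζ, coordMinor, ← hP, Fin.sum_univ_two]
      ring
    rw [mul_comm (X _), mul_assoc, hplucker, mul_add]
    refine Ideal.add_mem _ (Ideal.mul_mem_left _ _ (Ideal.mul_mem_left _ _ hmem)) ?_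
    rw [mul_left_comm]
    exact Ideal.mul_mem_left _ _ (ih hp.1)

theorem coordMinor_eq_sum (g : Fin n → Matrix (Fin 2) (Fin 2) L) (i j : Fin n) :
    coordMinor g i j = ∑ k, ∑ l,
      monomial (Finsupp.single (i, k) 1 + Finsupp.single (j, l) 1)
        (g i 0 k * g j 1 l - g j 0 l * g i 1 k) := by
  have hX : ∀ (k l : Fin 2) (c : L), monomial (Finsupp.single (i, k) 1 + Finsupp.single (j, l) 1) c =
      C c * (X (i, k) * X (j, l)) := by
    intro k l c
    simp [X, C_mul_monomial, monomial_mul]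
  simp only [hX, coordMinor, coordVec, Fin.sum_univ_two, map_sub, map_mul]
  ring

/-- The coefficient of `x_i x_j` is exactly the determinant that `IsGeneric` requires to be nonzero.
-/
theorem degree_coordMinor {m : MonomialOrder (Fin n × Fin 2)}
    (hm : ∀ i : Fin n, m.toSyn (Finsupp.single (i, 1) 1) < m.toSyn (Finsupp.single (i, 0) 1))
    {g : Fin n → Matrix (Fin 2) (Fin 2) L} (hg : IsGeneric g) {i j : Fin n} (hij : i ≠ j) :
    m.degree (coordMinor g i j) = Finsupp.single (i, 0) 1 + Finsupp.single (j, 0) 1 := by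
  classical
  have hle : ∀ i k, m.toSyn (Finsupp.single (i, k) 1) ≤ m.toSyn (Finsupp.single (i, 0) 1) := by
    intro i k
    fin_cases k
    exacts [le_rfl, (hm i).le]
  refine m.toSyn.injective (le_antisymm (m.degree_le_iff.2 fun c hc => ?_) (m.le_degree ?_))
  · rw [coordMinor_eq_sum] at hc
    obtain ⟨k, -, hc⟩ := Finset.mem_biUnion.1 (support_sum hc)
    obtain ⟨l, -, hc⟩ := Finset.mem_biUnion.1 (support_sum hc)
    rw [Finset.mem_singleton.1 (support_monomial_subset hc), map_add, map_add]
    exact add_le_add (hle i k) (hle j l)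
  · have hne : ∀ k l, (Finsupp.single (i, k) 1 + Finsupp.single (j, l) 1 : Fin n × Fin 2 →₀ ℕ) =
        Finsupp.single (i, 0) 1 + Finsupp.single (j, 0) 1 ↔ k = 0 ∧ l = 0 := by
      refine fun k l => ⟨fun h => ⟨?_, ?_⟩, by rintro ⟨rfl, rfl⟩; rfl⟩
      · by_contra hk
        simpa [hij, hij.symm, Finsupp.single_apply, Ne.symm hk] using DFunLike.congr_fun h (i, k)
      · by_contra hk
        simpa [hij, hij.symm, Finsupp.single_apply, Ne.symm hk] using DFunLike.congr_fun h (j, l)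
    rw [mem_support_iff, coordMinor_eq_sum]
    simp only [coeff_sum, coeff_monomial, hne]
    simpa [Fin.sum_univ_two] using hg i j hij

/-- Every monomial lying in all the ideals `U L T E` is a leading monomial of the transformed
binomial edge ideal. -/
theorem monomial_mem_initialIdeal {m : MonomialOrder (Fin n × Fin 2)}
    (hm : ∀ i : Fin n, m.toSyn (Finsupp.single (i, 1) 1) < m.toSyn (Finsupp.single (i, 0) 1))
    {g : Fin n → GL (Fin 2) L} (hg : IsGeneric fun i => (g i : Matrix (Fin 2) (Fin 2) L))
    {d : Fin n × Fin 2 →₀ ℕ}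
    (hd : ∀ T E, IsTransversal G T E → ∃ p ∈ variableSet T E, d p ≠ 0) :
    monomial d 1 ∈
      initialIdeal m (coordIdeal G fun i => (g i : Matrix (Fin 2) (Fin 2) L)) := by
  classical
  let T : Set (Fin n) := {i | d (i, 0) ≠ 0 ∨ d (i, 1) ≠ 0}
  obtain ⟨i, hi, j, hj, ⟨hiT, hjT, ⟨p⟩⟩, hij⟩ :
      ∃ i, d (i, 0) ≠ 0 ∧ ∃ j, d (j, 0) ≠ 0 ∧ Linked G T i j ∧ i ≠ j := by
    -- Otherwise the vertices `i` with `x_i` dividing the monomial extend to a transversal `E` of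
    -- its support `T`, and the monomial avoids `U L T E`.
    by_contra! hc
    obtain ⟨E, hBE, hE⟩ := exists_isTransversal (G := G) (B := {i | d (i, 0) ≠ 0}) (T := T)
      (fun i hi => .inl hi) fun i hi j hj hl => hc i hi j hj hl
    obtain ⟨⟨i, k⟩, hp, hdp⟩ := hd T E hE
    rcases hp with hp | ⟨hp, rfl : k = 0⟩
    · refine hp ?_
      fin_cases k
      exacts [.inl hdp, .inr hdp]
    · exact hp (hBE hdp)
  let q : G.Walk i j := p.bypass.map (SimpleGraph.Embedding.induce T).toHom
  have hq : q.IsPath :=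
    p.bypass_isPath.map Subtype.val_injective
  have hqT : ∀ a ∈ q.support, a ∈ T := by
    intro a ha
    rw [show q.support = _ from SimpleGraph.Walk.support_map _ _, List.mem_map] at ha
    obtain ⟨b, -, rfl⟩ := ha
    exact b.2
  -- At each inner vertex of the path, choose a variable that divides the given monomial.
  let κ : Fin n → Fin 2 := fun a => if d (a, 0) ≠ 0 then 0 else 1
  have hmem := prod_X_mul_coordMinor_mem g κ q hq
  set S := q.support.toFinset \ {i, j} with hS
  set h := (∏ a ∈ S, X (a, κ a)) * coordMinor (fun i => (g i : Matrix (Fin 2) (Fin 2) L)) i j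
    with hh
  have hF0 : coordMinor (fun i => (g i : Matrix (Fin 2) (Fin 2) L)) i j ≠ 0 := by
    intro h0
    have := degree_coordMinor hm hg hij
    rw [h0, m.degree_zero] at this
    simpa [Finsupp.single_apply, hij.symm] using DFunLike.congr_fun this (i, 0)
  have hprod : (∏ a ∈ S, X (a, κ a) : MvPolynomial (Fin n × Fin 2) L) =
      monomial (∑ a ∈ S, Finsupp.single (a, κ a) 1) 1 := by
    simp only [X, monomial_sum_one]
  have hprod0 : (∏ a ∈ S, X (a, κ a) : MvPolynomial (Fin n × Fin 2) L) ≠ 0 :=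
    Finset.prod_ne_zero_iff.2 fun a _ => X_ne_zero _
  have hdeg : m.degree h = (∑ a ∈ S, Finsupp.single (a, κ a) 1) +
      (Finsupp.single (i, 0) 1 + Finsupp.single (j, 0) 1) := by
    rw [hh, m.degree_mul hprod0 hF0, degree_coordMinor hm hg hij, hprod, m.degree_monomial,
      if_neg one_ne_zero]
  have hsum : ∀ b l, (∑ a ∈ S, Finsupp.single (a, κ a) 1 : Fin n × Fin 2 →₀ ℕ) (b, l) =
      if b ∈ S ∧ κ b = l then 1 else 0 := by
    intro b l
    rw [Finsupp.finsetSum_apply]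
    simp only [Finsupp.single_apply, Prod.mk.injEq, Finset.sum_boole]
    split_ifs with hb
    · rw [show S.filter (fun a => a = b ∧ κ a = l) = {b} by
        ext a; simp only [Finset.mem_filter, Finset.mem_singleton]; grind]
      simp
    · rw [show S.filter (fun a => a = b ∧ κ a = l) = ∅ by
        ext a; simp only [Finset.mem_filter, Finset.notMem_empty]; grind]
      simp
  have hle : m.degree h ≤ d := by
    rintro ⟨b, l⟩
    have h1 : b ∈ S → b ∈ T ∧ b ≠ i ∧ b ≠ j := fun hb => by
      rw [hS, Finset.mem_sdiff, List.mem_toFinset] at hb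
      exact ⟨hqT b hb.1, by simpa using hb.2⟩
    rw [hdeg, Finsupp.add_apply, Finsupp.add_apply, hsum, Finsupp.single_apply,
      Finsupp.single_apply]
    by_cases hb : b ∈ S
    · obtain ⟨hbT, hbi, hbj⟩ := h1 hb
      simp only [hb, true_and, Prod.mk.injEq, Ne.symm hbi, Ne.symm hbj, false_and, if_false,
        add_zero]
      split_ifs with hl
      · subst hl
        by_cases h0 : d (b, 0) = 0
        · simpa [κ, h0, Nat.one_le_iff_ne_zero] using hbT.resolve_left (not_not.2 h0)
        · simp [κ, h0, Nat.one_le_iff_ne_zero]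
      · exact Nat.zero_le _
    · simp only [hb, false_and, if_false, zero_add, Prod.mk.injEq]
      split_ifs with h2 h3 h3
      · exact (hij (h2.1.trans h3.1.symm)).elim
      · obtain ⟨rfl, rfl⟩ := h2
        omega
      · obtain ⟨rfl, rfl⟩ := h3
        omega
      · exact Nat.zero_le _
  have hlc : m.leadingCoeff h ≠ 0 := m.leadingCoeff_ne_zero_iff.2 (mul_ne_zero hprod0 hF0)
  have : monomial d (1 : L) = monomial (d - m.degree h) (m.leadingCoeff h)⁻¹ * m.leadingTerm h := by
    rw [MonomialOrder.leadingTerm, monomial_mul, tsub_add_cancel_of_le hle, inv_mul_cancel₀ hlc]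
  rw [this]
  exact Ideal.mul_mem_left _ _ (Ideal.subset_span ⟨h, hmem, rfl⟩)

end LeadingTerms

/-! ### Existence and uniqueness of the generic initial ideal. -/

section Gin

universe u

variable {n : ℕ} {K : Type u} [Field K]

theorem monomial_mem_ginIdeal_iff {G : SimpleGraph (Fin n)} {d : Fin n × Fin 2 →₀ ℕ} :
    monomial d (1 : K) ∈ ginIdeal K G ↔
      ∀ T E, IsTransversal G T E → ∃ p ∈ variableSet T E, d p ≠ 0 := by
  simp only [mem_ginIdeal_iff, monomial_mem_U_iff]

theorem initialIdeal_coordIdeal {L : Type*} [Field L] [Algebra K L] {G : SimpleGraph (Fin n)}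
    {m : MonomialOrder (Fin n × Fin 2)}
    (hm : ∀ i : Fin n, m.toSyn (Finsupp.single (i, 1) 1) < m.toSyn (Finsupp.single (i, 0) 1))
    {g : Fin n → GL (Fin 2) L} (hg : IsGeneric fun i => (g i : Matrix (Fin 2) (Fin 2) L)) :
    initialIdeal m (coordIdeal G fun i => (g i : Matrix (Fin 2) (Fin 2) L)) =
      (ginIdeal K G).map (MvPolynomial.map (algebraMap K L)) := by
  apply le_antisymm
  · refine Ideal.span_le.2 ?_
    rintro _ ⟨f, hf, rfl⟩
    by_cases hf0 : f = 0
    · simp [hf0]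
    have hd : monomial (m.degree f) (1 : K) ∈ ginIdeal K G := monomial_mem_ginIdeal_iff.2
      fun T E hE => exists_mem_variableSet_of_mem_coordIdeal hm hg hE hf hf0
    have : m.leadingTerm f = C (m.leadingCoeff f) *
        MvPolynomial.map (algebraMap K L) (monomial (m.degree f) 1) := by
      simp [MonomialOrder.leadingTerm, C_mul_monomial]
    rw [this]
    exact Ideal.mul_mem_left _ _ (Ideal.mem_map_of_mem _ hd)
  · refine Ideal.map_le_iff_le_comap.2 fun f hf => ?_
    rw [Ideal.mem_comap, f.as_sum, map_sum]
    refine Ideal.sum_mem _ fun d hd => ?_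
    have : MvPolynomial.map (algebraMap K L) (monomial d (coeff d f)) =
        C (algebraMap K L (coeff d f)) * monomial d 1 := by
      simp [C_mul_monomial]
    rw [this]
    exact Ideal.mul_mem_left _ _ (monomial_mem_initialIdeal hm hg fun T E hE =>
      mem_U_iff.1 (mem_ginIdeal_iff.1 hf T E hE) d hd)

theorem isMultigradedGin_ginIdeal (G : SimpleGraph (Fin n)) {m : MonomialOrder (Fin n × Fin 2)}
    (hm : ∀ i : Fin n, m.toSyn (Finsupp.single (i, 1) 1) < m.toSyn (Finsupp.single (i, 0) 1)) :
    IsMultigradedGin m (edgeIdeal K G) (ginIdeal K G) := by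
  classical
  refine ⟨∏ q : Fin n × Fin n, if q.1 = q.2 then 1 else
    (X (q.1, 0, 0) * X (q.2, 1, 0) - X (q.2, 0, 0) * X (q.1, 1, 0)), ?_, ?_⟩
  · refine Finset.prod_ne_zero_iff.2 fun q _ => ?_
    split_ifs with hq
    · exact one_ne_zero
    · intro h0
      -- At this point the factor takes the value 1.
      have := congrArg (eval fun e : Fin n × Fin 2 × Fin 2 =>
        if e = (q.1, 0, 0) ∨ e = (q.2, 1, 0) then (1 : K) else 0) h0
      simp [Ne.symm hq] at this
  · intro L _ _ g hg
    rw [map_edgeIdeal]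
    refine initialIdeal_coordIdeal hm fun i j hij => ?_
    rw [map_prod, Finset.prod_ne_zero_iff] at hg
    simpa [hij] using hg (i, j) (Finset.mem_univ _)

/-- A `K`-linear retraction `L → K`, applied to coefficients, is linear over polynomials with
coefficients in `K`; it maps the extended ideal back into `J` and fixes `f`. -/
theorem mem_of_map_mem_map {σ L : Type*} [Field L] [Algebra K L] {J : Ideal (MvPolynomial σ K)}
    {f : MvPolynomial σ K}
    (hf : MvPolynomial.map (algebraMap K L) f ∈ J.map (MvPolynomial.map (algebraMap K L))) :
    f ∈ J := by
  obtain ⟨r, hr⟩ := (Algebra.linearMap K L).exists_leftInverse_of_injective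
    (LinearMap.ker_eq_bot.2 (algebraMap K L).injective)
  let ρ : MvPolynomial σ L →ₗ[K] MvPolynomial σ K := (AddMonoidAlgebra.coeffLinearEquiv K).symm.toLinearMap ∘ₗ
    Finsupp.mapRange.linearMap r ∘ₗ (AddMonoidAlgebra.coeffLinearEquiv K).toLinearMap
  have hρ : ∀ p d, coeff d (ρ p) = r (coeff d p) := fun p d => rfl
  have hmul : ∀ p q, ρ (p * MvPolynomial.map (algebraMap K L) q) = ρ p * q := by
    classical
    intro p q
    ext d
    simp only [hρ, coeff_mul, map_sum, coeff_map]
    refine Finset.sum_congr rfl fun a _ => ?_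
    rw [mul_comm, ← Algebra.smul_def, map_smul, smul_eq_mul, mul_comm]
  have h1 : ρ (MvPolynomial.map (algebraMap K L) f) = f := by
    ext d
    rw [hρ, coeff_map]
    exact LinearMap.congr_fun hr (coeff d f)
  have h2 : ∀ p ∈ J.map (MvPolynomial.map (algebraMap K L)), ρ p ∈ J := by
    intro p hp
    -- Since `ρ` is not linear over polynomials with coefficients in `L`, the induction must carry
    -- all multiples of `p`.
    suffices h : ∀ a, ρ (a * p) ∈ J by simpa using h 1
    refine Submodule.span_induction (p := fun p _ => ∀ a, ρ (a * p) ∈ J) ?_ ?_ ?_ ?_ hp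
    · rintro _ ⟨q, hq, rfl⟩ a
      rw [hmul]
      exact J.mul_mem_left _ hq
    · simp
    · intro p q _ _ h h' a
      rw [mul_add, map_add]
      exact J.add_mem (h a) (h' a)
    · intro b p _ h a
      rw [smul_eq_mul, ← mul_assoc]
      exact h _
  exact h1 ▸ h2 _ hf

theorem map_injective {σ : Type*} (L : Type*) [Field L] [Algebra K L]
    {J J' : Ideal (MvPolynomial σ K)}
    (h : J.map (MvPolynomial.map (algebraMap K L)) = J'.map (MvPolynomial.map (algebraMap K L))) :
    J = J' :=
  le_antisymm (fun _ hf => mem_of_map_mem_map (h ▸ Ideal.mem_map_of_mem _ hf))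
    fun _ hf => mem_of_map_mem_map (h ▸ Ideal.mem_map_of_mem _ hf)

/-- The multigraded generic initial ideal is unique: compare at the generic point. -/
theorem IsMultigradedGin.unique {ι κ : Type} [Fintype κ] [DecidableEq κ]
    {m : MonomialOrder (ι × κ)} {I J J' : Ideal (MvPolynomial (ι × κ) K)}
    (h : IsMultigradedGin m I J) (h' : IsMultigradedGin m I J') : J = J' := by
  obtain ⟨D, hD, hJ⟩ := h
  obtain ⟨D', hD', hJ'⟩ := h'
  let R := MvPolynomial (ι × κ × κ) K
  let L := FractionRing R
  let A : ι → Matrix κ κ R := fun i => Matrix.of fun k l => X (i, k, l)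
  -- The matrix of indeterminates specializes to the identity, so it is invertible over the fraction
  -- field, where no nonzero `D` vanishes.
  have hA : ∀ i, (A i).det ≠ 0 := by
    intro i h0
    have h1 := congrArg (eval fun e : ι × κ × κ => if e.2.1 = e.2.2 then (1 : K) else 0) h0
    rw [RingHom.map_det, map_zero] at h1
    have : (eval fun e : ι × κ × κ => if e.2.1 = e.2.2 then (1 : K) else 0).mapMatrix (A i) = 1 := by
      ext k l
      simp [A, Matrix.one_apply]
    rw [this, Matrix.det_one] at h1
    exact one_ne_zero h1
  let g : ι → GL κ L := fun i => Matrix.GeneralLinearGroup.mkOfDetNeZero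
    ((algebraMap R L).mapMatrix (A i)) (by
      rw [← RingHom.map_det]
      exact (map_ne_zero_iff _ (IsFractionRing.injective R L)).2 (hA i))
  have hg : ∀ P : R, aeval (fun e : ι × κ × κ => (g e.1 : Matrix κ κ L) e.2.1 e.2.2) P =
      algebraMap R L P := by
    intro P
    have : aeval (fun e : ι × κ × κ => (g e.1 : Matrix κ κ L) e.2.1 e.2.2) =
        IsScalarTower.toAlgHom K R L := by
      ext e
      rw [aeval_X]
      rfl
    exact DFunLike.congr_fun this P
  have hne : ∀ P : R, P ≠ 0 →
      aeval (fun e : ι × κ × κ => (g e.1 : Matrix κ κ L) e.2.1 e.2.2) P ≠ 0 := fun P hP => by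
    rw [hg]
    exact (map_ne_zero_iff _ (IsFractionRing.injective R L)).2 hP
  exact map_injective L ((hJ L g (hne D hD)).symm.trans (hJ' L g (hne D' hD')))

end Gin

end BinomialEdge

theorem proposition2p2 {K : Type*} [Field K] {n : ℕ} (G : SimpleGraph (Fin n))
    (m : MonomialOrder (Fin n × Fin 2))
    (hm : ∀ i : Fin n, m.toSyn (Finsupp.single (i, 1) 1) < m.toSyn (Finsupp.single (i, 0) 1)) :
    (∃ J, BinomialEdge.IsMultigradedGin m (BinomialEdge.edgeIdeal K G) J) ∧
    ∀ J, BinomialEdge.IsMultigradedGin m (BinomialEdge.edgeIdeal K G) J →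
      J.minimalPrimes =
        {P | ∃ T E : Set (Fin n),
          (∀ i, i ∉ T →
            BinomialEdge.numComponents G (insert i T) < BinomialEdge.numComponents G T) ∧
          BinomialEdge.IsTransversal G T E ∧
          P = BinomialEdge.U K T E} := by
  have h := BinomialEdge.isMultigradedGin_ginIdeal (K := K) G hm
  refine ⟨⟨_, h⟩, fun J hJ => ?_⟩
  rw [hJ.unique h, BinomialEdge.minimalPrimes_ginIdeal]
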